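/- Let $\mathbb{Q}[[x_1,x_2,\ldots]]$ be the ring of formal power series in countably many variables (arbitrary infinite $\mathbb{Q}$-linear combinations of monomials of finite total degree), with the topology of coefficientwise convergence, $\mathbb{Q}$ being discrete. For a composition $\alpha=[\alpha_1,\ldots,\alpha_k]$ of an integer $d$ (positive parts with sum $d$), let $$M_\alpha=\sum_{i_1<i_2<\cdots<i_k}x_{i_1}^{\alpha_1}x_{i_2}^{\alpha_2}\cdots x_{i_k}^{\alpha_k}$$ be the monomial quasi-symmetric function and $F_\alpha=\sum_\beta M_\beta$ the fundamental quasi-symmetric function, the sum being over the compositions $\beta$ of $d$ that refine $\alpha$. Let $\mathcal{J}$ be the ideal of $\mathbb{Q}[[x_1,x_2,\ldots]]$ generated by all $F_\alpha$ with $\alpha$ a composition of an integer $d>0$ (these $F_\alpha$ form a linear basis of the space of quasi-symmetric functions with zero constant term), let $\overline{\mathcal{J}}$ be its closure, and let $R=\mathbb{Q}[[x_1,x_2,\ldots]]/\overline{\mathcal{J}}$ with the quotient topology. To a sequence $\tilde\alpha=(\tilde\alpha_1,\tilde\alpha_2,\ldots)$ of non-negative integers with finite sum, and to the monomial $X^{\tilde\alpha}=x_1^{\tilde\alpha_1}x_2^{\tilde\alpha_2}\cdots$,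 associate the lattice path $$(0,0)\to(\tilde\alpha_1,0)\to(\tilde\alpha_1,1)\to(\tilde\alpha_1+\tilde\alpha_2,1)\to(\tilde\alpha_1+\tilde\alpha_2,2)\to\cdots.$$ It is a Catalan path if it remains weakly above the line $y=x$, i.e. if $x\le y$ for every point $(x,y)$ of the path. **Theorem 1.** The monomials $X^{\tilde\alpha}$ whose path is a Catalan path form a Hilbert (topological) basis of $R$: for every family of coefficients $c_{\tilde\alpha}\in\mathbb{Q}$ indexed by the Catalan paths, the sum $\sum_{\tilde\alpha}c_{\tilde\alpha}X^{\tilde\alpha}$ converges in $R$, and every element of $R$ is the sum of exactly one such series. -/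

import Mathlib

/-!
The variables `x₁, x₂, x₃, …` are indexed by `ℕ` starting from zero: the index `i : ℕ` stands for
`x_{i+1}`. A generalized (infinite) composition, i.e. the exponent of a monomial, is `α : ℕ →₀ ℕ`.
-/

namespace QuasiSymm

/-- The ring `ℚ[[x₁, x₂, …]]` of formal power series in countably many variables
(arbitrary infinite `ℚ`-linear combinations of monomials). -/
abbrev Series : Type := MvPowerSeries ℕ ℚ

/-- The standard topology on formal power series: coefficientwise convergence, the field `ℚ` of
coefficients being discrete (not with its order topology). -/
instance instTopologicalSpaceSeries : TopologicalSpace Series :=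
  @MvPowerSeries.WithPiTopology.instTopologicalSpace ℕ ℚ ⊥

instance instIsTopologicalRingSeries : IsTopologicalRing Series := by
  let _ : TopologicalSpace ℚ := ⊥
  have : DiscreteTopology ℚ := ⟨rfl⟩
  exact MvPowerSeries.WithPiTopology.instIsTopologicalRing ℕ ℚ

open Classical in
/-- The monomial quasi-symmetric function
`M_α = ∑_{i₁ < i₂ < ⋯ < i_k} x_{i₁}^{α₁} ⋯ x_{i_k}^{α_k}` of a composition `α` of `d`.
The monomials of this sum are pairwise distinct, so all coefficients are `0` or `1`. -/
noncomputable def monomialQuasiSymm {d : ℕ} (α : Composition d) : Series :=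
  fun m => if ∃ i : Fin α.length → ℕ, StrictMono i ∧
    m = ∑ l, Finsupp.single (i l) (α.blocksFun l) then 1 else 0

/-- The fundamental quasi-symmetric function `F_α = ∑ M_β`, over all compositions `β` of `d`
that refine `α` (the set of partial sums of `β` contains that of `α`). -/
noncomputable def fundamentalQuasiSymm {d : ℕ} (α : Composition d) : Series :=
  ∑ β : Composition d with α.boundaries ⊆ β.boundaries, monomialQuasiSymm β

/-- The ideal `J` of `ℚ[[x₁, x₂, …]]` generated by the fundamental quasi-symmetric functions
`F_α`, for all compositions `α` of all integers `d > 0`. -/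
noncomputable def idealJ : Ideal Series :=
  Ideal.span {f | ∃ (d : ℕ) (α : Composition d), 0 < d ∧ f = fundamentalQuasiSymm α}

/-- The quotient `R` of `ℚ[[x₁, x₂, …]]` by the topological closure of `J`. It carries the
quotient topology. -/
abbrev R : Type := Series ⧸ idealJ.closure

/-- The class in `R` of the monomial `x₁^{α₁} x₂^{α₂} ⋯`. -/
noncomputable def monomialClass (α : ℕ →₀ ℕ) : R :=
  Ideal.Quotient.mk idealJ.closure (MvPowerSeries.monomial α (1 : ℚ))

/-- The lattice points of the path
`(0,0) → (α₁,0) → (α₁,1) → (α₁+α₂,1) → (α₁+α₂,2) → ⋯`: at height `y` it goes east from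
`α₁ + ⋯ + α_y` to `α₁ + ⋯ + α_{y+1}`, and then one step north. -/
def pathPoints (α : ℕ →₀ ℕ) : Set (ℕ × ℕ) :=
  {p | ∑ i ∈ Finset.range p.2, α i ≤ p.1 ∧ p.1 ≤ ∑ i ∈ Finset.range (p.2 + 1), α i}

/-- The path of `α` is a Catalan path: it remains (weakly) above the line `y = x`. -/
def IsCatalan (α : ℕ →₀ ℕ) : Prop :=
  ∀ p ∈ pathPoints α, p.1 ≤ p.2

/-- A family `b` is a Hilbert basis (over the discrete field `ℚ`) of a topological `ℚ`-vector space
`M` if all infinite linear combinations `∑ i, c i • b i` converge, and every element of `M` is the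
sum of exactly one of them. -/
structure IsHilbertBasis {ι M : Type*} [AddCommGroup M] [Module ℚ M] [TopologicalSpace M]
    (b : ι → M) : Prop where
  summable : ∀ c : ι → ℚ, Summable fun i => c i • b i
  existsUnique_hasSum : ∀ m : M, ∃! c : ι → ℚ, HasSum (fun i => c i • b i) m

end QuasiSymm

/-!
A series `f` is quasi-symmetric exactly when it does not change if a variable `x_i` is set to zero
and the later ones are renumbered; write `delete i` for this substitution. Hence the trimming
operators `trim i f = (delete (i + 1) f - delete i f) / x_i` are linear over the quasi-symmetric
series (`trim_mul`), and they preserve the ideal `J` (`trim_mem_idealJ`). So every composite of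
trimming operators and the constant coefficient is a functional which kills `J`. A trimming operator
sends a monomial to zero or, up to sign, to a monomial of smaller degree, and each Catalan monomial
can be trimmed down to `1` through Catalan monomials. The functionals obtained in this way are
unitriangular on the Catalan monomials with respect to the lexicographic order
(`IsCatalan.exists_functional`), which gives the linear independence of these monomials modulo `J`
(`coeff_eq_zero_of_mem_idealJ`).

For the spanning part, `leadingSeries` deforms the fundamental quasi-symmetric functions into series
with an arbitrary leading exponent `ε` in the lexicographic order. The leading term is
found by splitting off the first variable (`isTop_leadingSeries`), while the recursion which defines
these series shows that they belong to `J` as soon as the path of `ε` crosses the line `y = x`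
(`leadingSeries_mem_idealJ`). So all exponents which are not Catalan are leading exponents of
elements of `J`, and in a finite box of exponents every series can be reduced to Catalan
monomials (`idealJ_sup_catalanOnBox`).

By independence the reductions in larger and larger boxes are compatible, and they define the
coefficients of the series of Catalan monomials that represents a given class in the quotient by the
closure of `J` (`exists_sub_catalanSeries_mem`).
-/

namespace QuasiSymm

open MvPowerSeries Finset

/-! ### Inserting and deleting a variable -/

/-- The increasing map `ℕ → ℕ` whose image misses exactly `i`. -/
def skip (i j : ℕ) : ℕ := if j < i then j else j + 1

lemma skip_strictMono (i : ℕ) : StrictMono (skip i) := by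
  intro a b h
  unfold skip
  split_ifs <;> omega

lemma skip_injective (i : ℕ) : Function.Injective (skip i) := (skip_strictMono i).injective

lemma skip_of_lt {i j : ℕ} (h : j < i) : skip i j = j := if_pos h

lemma skip_of_le {i j : ℕ} (h : i ≤ j) : skip i j = j + 1 := if_neg (by omega)

lemma skip_ne (i j : ℕ) : skip i j ≠ i := by
  unfold skip
  split_ifs <;> omega

lemma exists_skip {i k : ℕ} (h : k ≠ i) : ∃ j, skip i j = k := by
  rcases lt_or_gt_of_ne h with h | h
  · exact ⟨k, skip_of_lt h⟩
  · exact ⟨k - 1, by rw [skip_of_le (by omega)]; omega⟩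

/-- The exponent `(m₀, …, m_{i-1}, 0, m_i, …)`. -/
noncomputable def insertZero (i : ℕ) : (ℕ →₀ ℕ) →+ (ℕ →₀ ℕ) :=
  Finsupp.mapDomain.addMonoidHom (skip i)

lemma insertZero_injective (i : ℕ) : Function.Injective (insertZero i) :=
  Finsupp.mapDomain_injective (skip_injective i)

@[simp] lemma insertZero_skip (i j : ℕ) (m : ℕ →₀ ℕ) : insertZero i m (skip i j) = m j :=
  Finsupp.mapDomain_apply (skip_injective i) m j

@[simp] lemma insertZero_self (i : ℕ) (m : ℕ →₀ ℕ) : insertZero i m i = 0 :=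
  Finsupp.mapDomain_of_notMem_range m i (by rintro ⟨j, h⟩; exact skip_ne i j h)

lemma insertZero_of_lt {i j : ℕ} (h : j < i) (m : ℕ →₀ ℕ) : insertZero i m j = m j := by
  simpa [skip_of_lt h] using insertZero_skip i j m

lemma insertZero_succ {i j : ℕ} (h : i ≤ j) (m : ℕ →₀ ℕ) : insertZero i m (j + 1) = m j := by
  simpa [skip_of_le h] using insertZero_skip i j m

lemma insertZero_single (i j a : ℕ) :
    insertZero i (Finsupp.single j a) = Finsupp.single (skip i j) a :=
  Finsupp.mapDomain_single

lemma degree_insertZero (i : ℕ) (m : ℕ →₀ ℕ) : (insertZero i m).degree = m.degree :=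
  Finsupp.degree_mapDomain _ _

lemma exists_insertZero {i : ℕ} {m : ℕ →₀ ℕ} (h : m i = 0) : ∃ m', insertZero i m' = m := by
  refine ⟨m.comapDomain (skip i) (skip_injective i).injOn,
    Finsupp.mapDomain_comapDomain _ (skip_injective i) m ?_⟩
  intro k hk
  refine exists_skip ?_
  rintro rfl
  simp [h] at hk

/-- Where `m` has a zero already, it does not matter on which side of it a zero is inserted. -/
lemma insertZero_succ_eq {i : ℕ} {m : ℕ →₀ ℕ} (h : m i = 0) :
    insertZero (i + 1) m = insertZero i m := by
  ext k
  rcases lt_trichotomy k i with hk | rfl | hk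
  · rw [insertZero_of_lt hk, insertZero_of_lt (by omega)]
  · rw [insertZero_of_lt (by omega), insertZero_self, h]
  · obtain ⟨k, rfl⟩ : ∃ l, k = l + 1 := ⟨k - 1, by omega⟩
    rw [insertZero_succ (i := i) (by omega)]
    rcases eq_or_lt_of_le (show i ≤ k by omega) with rfl | hk
    · rw [insertZero_self, h]
    · rw [insertZero_succ (by omega)]

/-- The series `f(x₀, …, x_{i-1}, 0, x_i, …)`, in which the variable `x_i` has been set to zero
and the later ones have been renumbered. -/
noncomputable def delete (i : ℕ) : Series →ₗ[ℚ] Series where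
  toFun f := fun m => f (insertZero i m)
  map_add' _ _ := rfl
  map_smul' _ _ := rfl

lemma coeff_delete (i : ℕ) (f : Series) (m : ℕ →₀ ℕ) :
    coeff m (delete i f) = coeff (insertZero i m) f := rfl

lemma delete_mul (i : ℕ) (f g : Series) : delete i (f * g) = delete i f * delete i g := by
  ext m
  rw [coeff_delete, coeff_mul, coeff_mul]
  symm
  refine Finset.sum_nbij (fun p => (insertZero i p.1, insertZero i p.2)) ?_ ?_ ?_ ?_
  · rintro ⟨a, b⟩ h
    rw [HasAntidiagonal.mem_antidiagonal] at h ⊢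
    rw [← h, map_add]
  · rintro ⟨a, b⟩ - ⟨c, d⟩ - h
    simp only [Prod.mk.injEq] at h
    rw [insertZero_injective i h.1, insertZero_injective i h.2]
  · rintro ⟨a, b⟩ h
    rw [mem_coe, HasAntidiagonal.mem_antidiagonal] at h
    have h0 : a i + b i = 0 := by simpa using DFunLike.congr_fun h i
    obtain ⟨a, rfl⟩ := exists_insertZero (i := i) (m := a) (by omega)
    obtain ⟨b, rfl⟩ := exists_insertZero (i := i) (m := b) (by omega)
    refine ⟨(a, b), ?_, rfl⟩
    rw [mem_coe, HasAntidiagonal.mem_antidiagonal]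
    exact insertZero_injective i (by rw [map_add, h])
  · intro p _
    rfl

/-- The quasi-symmetric divided difference (trimming operator)
`(delete (i + 1) f - delete i f) / x_i`, given by its coefficients. -/
noncomputable def trim (i : ℕ) : Series →ₗ[ℚ] Series where
  toFun f := fun m => f (insertZero (i + 1) (m + Finsupp.single i 1)) -
    f (insertZero i (m + Finsupp.single i 1))
  map_add' f g := by
    funext m
    change (f _ + g _) - (f _ + g _) = (f _ - f _) + (g _ - g _)
    ring
  map_smul' c f := by
    funext m
    change c * f _ - c * f _ = c * (f _ - f _)
    ring

lemma coeff_trim (i : ℕ) (f : Series) (m : ℕ →₀ ℕ) :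
    coeff m (trim i f) = coeff (insertZero (i + 1) (m + Finsupp.single i 1)) f -
      coeff (insertZero i (m + Finsupp.single i 1)) f := rfl

lemma coeff_X_mul_of_eq_zero {i : ℕ} {m : ℕ →₀ ℕ} (h : m i = 0) (f : Series) :
    coeff m (X i * f) = 0 := by
  classical
  rw [X, coeff_monomial_mul, if_neg]
  intro hle
  simpa [h] using hle i

lemma coeff_add_single_X_mul (i : ℕ) (m : ℕ →₀ ℕ) (f : Series) :
    coeff (m + Finsupp.single i 1) (X i * f) = coeff m f := by
  rw [X, add_comm, coeff_add_monomial_mul, one_mul]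

lemma exists_add_single {i : ℕ} {m : ℕ →₀ ℕ} (h : m i ≠ 0) :
    ∃ m', m = m' + Finsupp.single i 1 :=
  ⟨m - Finsupp.single i 1, (tsub_add_cancel_of_le (by
    rw [Finsupp.single_le_iff]; omega)).symm⟩

lemma X_mul_trim (i : ℕ) (f : Series) : X i * trim i f = delete (i + 1) f - delete i f := by
  ext m
  rw [map_sub, coeff_delete, coeff_delete]
  by_cases h : m i = 0
  · rw [coeff_X_mul_of_eq_zero h, insertZero_succ_eq h, sub_self]
  · obtain ⟨m, rfl⟩ := exists_add_single h
    rw [coeff_add_single_X_mul, coeff_trim]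

/-- The operators `trim i` are linear over the quasi-symmetric series, as these are fixed by
`delete`. -/
lemma trim_mul (i : ℕ) (f g : Series) (hg : ∀ k, delete k g = g) :
    trim i (f * g) = trim i f * g := by
  have hX : (X i : Series) ≠ 0 := fun h => by
    simpa using congrArg (coeff (Finsupp.single i 1)) h
  apply mul_left_cancel₀ hX
  rw [X_mul_trim, delete_mul, delete_mul, hg, hg, ← mul_assoc, X_mul_trim, sub_mul]

/-! ### The ideal is stable under trimming -/

open Classical in
lemma delete_monomialQuasiSymm (i : ℕ) {d : ℕ} (α : Composition d) :
    delete i (monomialQuasiSymm α) = monomialQuasiSymm α := by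
  funext m
  change (if _ then _ else _) = (if _ then _ else _)
  congr 1
  rw [eq_iff_iff]
  constructor
  · rintro ⟨k, hk, hm⟩
    have hne : ∀ l, k l ≠ i := by
      intro l hl
      have h0 : (∑ l, Finsupp.single (k l) (α.blocksFun l)) i = 0 := by
        rw [← hm, insertZero_self]
      rw [Finsupp.finsetSum_apply, Finset.sum_eq_zero_iff] at h0
      have := h0 l (mem_univ l)
      rw [hl, Finsupp.single_eq_same] at this
      have := α.one_le_blocksFun l
      omega
    choose k' hk' using fun l => exists_skip (hne l)
    refine ⟨k', fun a b hab => (skip_strictMono i).lt_iff_lt.1 ?_, insertZero_injective i ?_⟩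
    · rw [hk', hk']
      exact hk hab
    · rw [hm, map_sum]
      exact Finset.sum_congr rfl fun l _ => by rw [insertZero_single, hk']
  · rintro ⟨k, hk, rfl⟩
    refine ⟨skip i ∘ k, (skip_strictMono i).comp hk, ?_⟩
    rw [map_sum]
    exact Finset.sum_congr rfl fun l _ => insertZero_single _ _ _

lemma delete_fundamentalQuasiSymm (i : ℕ) {d : ℕ} (α : Composition d) :
    delete i (fundamentalQuasiSymm α) = fundamentalQuasiSymm α := by
  unfold fundamentalQuasiSymm
  rw [map_sum]
  exact Finset.sum_congr rfl fun β _ => delete_monomialQuasiSymm i β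

open Classical in
lemma coeff_zero_monomialQuasiSymm {d : ℕ} (hd : 0 < d) (α : Composition d) :
    coeff 0 (monomialQuasiSymm α) = 0 := by
  change (if _ then _ else _) = _
  rw [if_neg]
  rintro ⟨k, -, h⟩
  have h' := congrArg Finsupp.degree h
  rw [map_sum, map_zero] at h'
  simp only [Finsupp.degree_single, Composition.sum_blocksFun] at h'
  omega

lemma coeff_zero_fundamentalQuasiSymm {d : ℕ} (hd : 0 < d) (α : Composition d) :
    coeff 0 (fundamentalQuasiSymm α) = 0 := by
  unfold fundamentalQuasiSymm
  rw [map_sum]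
  exact Finset.sum_eq_zero fun β _ => coeff_zero_monomialQuasiSymm hd β

lemma coeff_zero_of_mem_idealJ {f : Series} (hf : f ∈ idealJ) : coeff 0 f = 0 := by
  have : idealJ ≤ RingHom.ker (constantCoeff : Series →+* ℚ) := by
    refine Ideal.span_le.2 ?_
    rintro _ ⟨d, α, hd, rfl⟩
    exact coeff_zero_fundamentalQuasiSymm hd α
  exact this hf

lemma trim_mem_idealJ (i : ℕ) {f : Series} (hf : f ∈ idealJ) : trim i f ∈ idealJ := by
  suffices h : ∀ p, trim i (p * f) ∈ idealJ by simpa using h 1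
  unfold idealJ at hf
  induction hf using Submodule.span_induction with
  | mem f hf =>
    intro p
    obtain ⟨d, α, hd, rfl⟩ := hf
    rw [trim_mul i p _ fun k => delete_fundamentalQuasiSymm k α]
    exact Ideal.mul_mem_left _ _ (Ideal.subset_span ⟨d, α, hd, rfl⟩)
  | zero => simp
  | add f g _ _ hf hg => intro p; rw [mul_add, map_add]; exact add_mem (hf p) (hg p)
  | smul a f _ hf => intro p; rw [smul_eq_mul, ← mul_assoc]; exact hf _

/-! ### Partial sums and Catalan exponents -/

/-- The partial sum `m₀ + ⋯ + m_{n-1}`. -/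
def psum (m : ℕ →₀ ℕ) (n : ℕ) : ℕ := ∑ i ∈ range n, m i

@[simp] lemma psum_zero (m : ℕ →₀ ℕ) : psum m 0 = 0 := rfl

lemma psum_succ (m : ℕ →₀ ℕ) (n : ℕ) : psum m (n + 1) = psum m n + m n := sum_range_succ _ _

lemma psum_add (m m' : ℕ →₀ ℕ) (n : ℕ) : psum (m + m') n = psum m n + psum m' n :=
  sum_add_distrib

lemma psum_single_of_lt {i n : ℕ} (h : i < n) : psum (Finsupp.single i 1) n = 1 := by
  unfold psum
  rw [sum_eq_single_of_mem i (mem_range.2 h) fun j _ hj => Finsupp.single_eq_of_ne hj,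
    Finsupp.single_eq_same]

lemma psum_insertZero_of_le {i k : ℕ} (h : k ≤ i) (m : ℕ →₀ ℕ) :
    psum (insertZero i m) k = psum m k :=
  sum_congr rfl fun j hj => insertZero_of_lt (by rw [mem_range] at hj; omega) m

lemma psum_insertZero_succ {i k : ℕ} (h : i ≤ k) (m : ℕ →₀ ℕ) :
    psum (insertZero i m) (k + 1) = psum m k := by
  induction k, h using Nat.le_induction with
  | base => rw [psum_succ, insertZero_self, psum_insertZero_of_le le_rfl, add_zero]
  | succ k hk ih => rw [psum_succ, ih, insertZero_succ hk, psum_succ]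

lemma isCatalan_iff {m : ℕ →₀ ℕ} : IsCatalan m ↔ ∀ n, psum m (n + 1) ≤ n := by
  constructor
  · intro h n
    exact h (psum m (n + 1), n) ⟨sum_le_sum_of_subset (range_mono n.le_succ), le_rfl⟩
  · rintro h ⟨x, y⟩ ⟨-, hx⟩
    exact hx.trans (h y)

/-- Every non-zero Catalan exponent arises from a Catalan exponent of smaller degree by adding a
factor `x_i` and inserting a zero before position `i`. -/
lemma IsCatalan.exists_eq_insertZero {c : ℕ →₀ ℕ} (hc : IsCatalan c) (h0 : c ≠ 0) :
    ∃ i d, IsCatalan d ∧ c = insertZero i (d + Finsupp.single i 1) := by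
  rw [isCatalan_iff] at hc
  have hex : ∃ k, c k ≠ 0 := by
    by_contra! h
    exact h0 (Finsupp.ext h)
  obtain ⟨k, hk, hmin⟩ : ∃ k, c k ≠ 0 ∧ ∀ j < k, c j = 0 :=
    ⟨Nat.find hex, Nat.find_spec hex, fun j hj => not_not.1 (Nat.find_min hex hj)⟩
  have hc0 : c 0 = 0 := by simpa [psum] using hc 0
  obtain ⟨i, rfl⟩ : ∃ i, k = i + 1 := ⟨k - 1, by
    have : k ≠ 0 := by rintro rfl; exact hk hc0
    omega⟩
  obtain ⟨c', rfl⟩ := exists_insertZero (hmin i (by omega))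
  rw [insertZero_succ le_rfl] at hk
  obtain ⟨d, rfl⟩ := exists_add_single hk
  refine ⟨i, d, isCatalan_iff.2 fun n => ?_, rfl⟩
  rcases le_or_gt i n with h | h
  · have := hc (n + 1)
    rw [psum_insertZero_succ (by omega), psum_add, psum_single_of_lt (by omega)] at this
    omega
  · have := hc n
    rw [psum_insertZero_of_le (by omega), psum_add] at this
    omega

/-! ### Functionals vanishing on the ideal -/

lemma toLex_lt_of {a b : ℕ →₀ ℕ} (j : ℕ) (h : ∀ k < j, a k = b k) (hj : a j < b j) :
    toLex a < toLex b :=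
  Finsupp.Lex.lt_iff.2 ⟨j, h, hj⟩

lemma toLex_lt_iff {a b : ℕ →₀ ℕ} :
    toLex a < toLex b ↔ ∃ j, (∀ k < j, a k = b k) ∧ a j < b j :=
  Finsupp.Lex.lt_iff

lemma toLex_insertZero_le (i : ℕ) {a b : ℕ →₀ ℕ} (h : toLex a ≤ toLex b) :
    toLex (insertZero i a) ≤ toLex (insertZero i b) := by
  rcases h.eq_or_lt with h | h
  · rw [toLex_inj.1 h]
  · obtain ⟨j, hlt, hj⟩ := toLex_lt_iff.1 h
    refine (toLex_lt_of (skip i j) (fun k hk => ?_) (by simpa using hj)).le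
    by_cases hki : k = i
    · rw [hki, insertZero_self, insertZero_self]
    · obtain ⟨k, rfl⟩ := exists_skip hki
      rw [insertZero_skip, insertZero_skip, hlt k ((skip_strictMono i).lt_iff_lt.1 hk)]

lemma toLex_insertZero_lt_insertZero_succ (i : ℕ) {a b : ℕ →₀ ℕ} (h : toLex a ≤ toLex b) :
    toLex (insertZero i (a + Finsupp.single i 1)) <
      toLex (insertZero (i + 1) (b + Finsupp.single i 1)) := by
  have hl : ∀ k < i, insertZero i (a + Finsupp.single i 1) k = a k := fun k hk => by
    rw [insertZero_of_lt hk, Finsupp.add_apply, Finsupp.single_eq_of_ne hk.ne, add_zero]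
  have hr : ∀ k < i, insertZero (i + 1) (b + Finsupp.single i 1) k = b k := fun k hk => by
    rw [insertZero_of_lt (by omega), Finsupp.add_apply, Finsupp.single_eq_of_ne hk.ne, add_zero]
  by_cases heq : ∀ k < i, a k = b k
  · refine toLex_lt_of i (fun k hk => by rw [hl k hk, hr k hk, heq k hk]) ?_
    rw [insertZero_self, insertZero_of_lt (by omega)]
    simp
  · have hne : a ≠ b := by
      rintro rfl
      exact heq fun _ _ => rfl
    obtain ⟨j, hlt, hj⟩ := toLex_lt_iff.1 (h.lt_of_ne fun h => hne (toLex_inj.1 h))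
    have hji : j < i := by
      by_contra! hij
      exact heq fun k hk => hlt k (by omega)
    refine toLex_lt_of j (fun k hk => ?_) ?_
    · rw [hl k (by omega), hr k (by omega), hlt k hk]
    · rwa [hl j hji, hr j hji]

/-- `IsConfined c m` says that `m` has the degree of `c` and involves no variable beyond the last
one of `c`. -/
def IsConfined (c m : ℕ →₀ ℕ) : Prop :=
  m.degree = c.degree ∧ ∀ n, (∀ i, n ≤ i → c i = 0) → ∀ i, n ≤ i → m i = 0

lemma IsConfined.insertZero {i i' : ℕ} {d m : ℕ →₀ ℕ} (h : IsConfined d m) (hi : i' ≤ i + 1) :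
    IsConfined (insertZero i (d + Finsupp.single i 1))
      (insertZero i' (m + Finsupp.single i 1)) := by
  refine ⟨?_, fun n hn j hj => ?_⟩
  · rw [degree_insertZero, degree_insertZero, map_add, map_add, h.1]
  · have hin : i + 2 ≤ n := by
      by_contra! hlt
      have := hn (i + 1) (by omega)
      rw [insertZero_succ le_rfl] at this
      simp at this
    obtain ⟨j, rfl⟩ : ∃ k, j = k + 1 := ⟨j - 1, by omega⟩
    have hd : ∀ k, n - 1 ≤ k → d k = 0 := fun k hk => by
      have := hn (k + 1) (by omega)
      rw [insertZero_succ (by omega), Finsupp.add_apply] at this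
      omega
    rw [insertZero_succ (by omega), Finsupp.add_apply, h.2 (n - 1) hd j (by omega),
      Finsupp.single_eq_of_ne (by omega), add_zero]

/-- For each Catalan exponent `c` some composite of trimming operators and the constant coefficient
is a functional which kills the ideal, and which is triangular with respect to the lexicographic
order: it is `1` at `X^c` and only involves coefficients at exponents that are at least `c`. -/
lemma IsCatalan.exists_functional {c : ℕ →₀ ℕ} (hc : IsCatalan c) :
    ∃ φ : Series →ₗ[ℚ] ℚ, (∀ f ∈ idealJ, φ f = 0) ∧ φ (monomial c 1) = 1 ∧
      ∀ f, (∀ m, toLex c ≤ toLex m → IsConfined c m → coeff m f = 0) → φ f = 0 := by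
  classical
  induction hN : c.degree using Nat.strong_induction_on generalizing c with
  | _ N ih =>
  by_cases h0 : c = 0
  · subst h0
    refine ⟨coeff 0, fun f hf => coeff_zero_of_mem_idealJ hf, coeff_monomial_same _ _,
      fun f hf => hf 0 le_rfl ⟨rfl, fun _ _ _ _ => rfl⟩⟩
  · obtain ⟨i, d, hd, rfl⟩ := hc.exists_eq_insertZero h0
    have hdeg : d.degree < N := by
      rw [← hN, degree_insertZero, map_add, Finsupp.degree_single]
      omega
    obtain ⟨φ, hJ, h1, htri⟩ := ih _ hdeg hd rfl
    refine ⟨-(φ ∘ₗ trim i), fun f hf => ?_, ?_, fun f hf => ?_⟩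
    · simp [hJ _ (trim_mem_idealJ i hf)]
    · have : trim i (monomial (insertZero i (d + Finsupp.single i 1)) 1) = -monomial d 1 := by
        ext m
        rw [coeff_trim, coeff_monomial, coeff_monomial, map_neg, coeff_monomial, if_neg, zero_sub]
        · simp only [(insertZero_injective i).eq_iff, add_left_inj]
        · intro h
          have := DFunLike.congr_fun h i
          rw [insertZero_self, insertZero_of_lt (by omega)] at this
          simp at this
      rw [LinearMap.neg_apply, LinearMap.comp_apply, this, map_neg, h1, neg_neg]
    · rw [LinearMap.neg_apply, LinearMap.comp_apply, htri, neg_zero]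
      intro m hm hconf
      rw [coeff_trim, hf _ (toLex_insertZero_lt_insertZero_succ i hm).le
        (hconf.insertZero le_rfl), hf _ (toLex_insertZero_le i ?_) (hconf.insertZero (by omega)),
        sub_zero]
      exact add_le_add_left hm (toLex (Finsupp.single i 1))

/-! ### Finite boxes of exponents and independence -/

/-- The exponents in the first `n` variables of degree at most `n`. These sets are finite and
exhaust all exponents. -/
def box (n : ℕ) : Set (ℕ →₀ ℕ) := {m | (∀ i, n ≤ i → m i = 0) ∧ m.degree ≤ n}

lemma box_mono : Monotone box := fun _ _ h _ hm =>
  ⟨fun i hi => hm.1 i (h.trans hi), hm.2.trans h⟩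

lemma exists_mem_box (m : ℕ →₀ ℕ) : ∃ n, m ∈ box n := by
  refine ⟨max (m.support.sup id + 1) m.degree, fun i hi => ?_, le_max_right _ _⟩
  by_contra h
  have := Finset.le_sup (f := id) (Finsupp.mem_support_iff.2 h)
  simp only [id] at this
  omega

lemma finite_box (n : ℕ) : (box n).Finite := by
  refine Set.Finite.of_injOn (f := fun m (i : Fin n) => m i)
    (t := Set.pi Set.univ fun _ => Set.Iic n) ?_ ?_ (Set.Finite.pi fun _ => Set.finite_Iic n)
  · intro m hm i _
    exact (Finsupp.le_degree _ m).trans hm.2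
  · intro m hm m' hm' h
    ext i
    by_cases hi : i < n
    · exact congrFun h ⟨i, hi⟩
    · rw [hm.1 i (by omega), hm'.1 i (by omega)]

lemma IsConfined.mem_box {c m : ℕ →₀ ℕ} {n : ℕ} (h : IsConfined c m) (hc : c ∈ box n) :
    m ∈ box n :=
  ⟨h.2 n hc.1, h.1.trans_le hc.2⟩

/-- Independence of the Catalan monomials modulo the ideal, in a finite box. -/
lemma coeff_eq_zero_of_mem_idealJ {f : Series} (hf : f ∈ idealJ) {n : ℕ}
    (hcat : ∀ m ∈ box n, ¬ IsCatalan m → coeff m f = 0) {m : ℕ →₀ ℕ} (hm : m ∈ box n) :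
    coeff m f = 0 := by
  by_contra hne
  have hfin : {m | m ∈ box n ∧ coeff m f ≠ 0}.Finite := (finite_box n).subset fun _ h => h.1
  -- At the lexicographically largest exponent of `f` in the box, triangularity isolates one term.
  obtain ⟨c, ⟨hc, hcf⟩, hmax⟩ := hfin.exists_maximalFor toLex _ ⟨m, hm, hne⟩
  obtain ⟨φ, hJ, h1, htri⟩ := (not_imp_comm.1 (hcat c hc) hcf).exists_functional
  have h := htri (f - coeff c f • monomial c 1) fun m hle hconf => ?_
  · rw [map_sub, hJ f hf, map_smul, h1, smul_eq_mul, mul_one, zero_sub, neg_eq_zero] at h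
    exact hcf h
  · rw [map_sub, map_smul, smul_eq_mul]
    by_cases hmc : m = c
    · rw [hmc, coeff_monomial_same, mul_one, sub_self]
    · rw [coeff_monomial_ne hmc, mul_zero, sub_zero]
      by_contra hmf
      exact hmc (toLex_inj.1 (le_antisymm (hmax ⟨hconf.mem_box hc, hmf⟩ hle) hle))

/-! ### Coefficients of the fundamental quasi-symmetric functions -/

/-- `Fits l m` says that `m` has degree `∑ l` and that every partial sum of the list `l` is a
partial sum of `m`: after removal of its zeros, `m` refines `l`. -/
def Fits (l : List ℕ) (m : ℕ →₀ ℕ) : Prop :=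
  m.degree = l.sum ∧ ∀ j, ∃ k, psum m k = (l.take j).sum

open Classical in
/-- The fundamental quasi-symmetric function of a list, given by its coefficients. -/
noncomputable def fund (l : List ℕ) : Series := fun m => if Fits l m then 1 else 0

open Classical in
lemma coeff_fund (l : List ℕ) (m : ℕ →₀ ℕ) : coeff m (fund l) = if Fits l m then 1 else 0 := rfl

lemma coeff_fund_of_fits {l : List ℕ} {m : ℕ →₀ ℕ} (h : Fits l m) : coeff m (fund l) = 1 :=
  if_pos h

lemma coeff_fund_of_not_fits {l : List ℕ} {m : ℕ →₀ ℕ} (h : ¬ Fits l m) :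
    coeff m (fund l) = 0 :=
  if_neg h

lemma coeff_fund_congr {l l' : List ℕ} {m m' : ℕ →₀ ℕ} (h : Fits l m ↔ Fits l' m') :
    coeff m (fund l) = coeff m' (fund l') := by
  by_cases hf : Fits l m
  · rw [coeff_fund_of_fits hf, coeff_fund_of_fits (h.1 hf)]
  · rw [coeff_fund_of_not_fits hf, coeff_fund_of_not_fits (mt h.2 hf)]

lemma mem_boundaries_iff {d : ℕ} (α : Composition d) (x : Fin (d + 1)) :
    x ∈ α.boundaries ↔ ∃ j, α.sizeUpTo j = x := by
  simp only [Composition.boundaries, Finset.mem_map, mem_univ, true_and]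
  constructor
  · rintro ⟨i, rfl⟩
    exact ⟨i, rfl⟩
  · rintro ⟨j, hj⟩
    rcases le_or_gt j α.length with h | h
    · exact ⟨⟨j, by omega⟩, Fin.ext hj⟩
    · refine ⟨Fin.last _, Fin.ext ?_⟩
      rw [← hj, α.sizeUpTo_ofLength_le j h.le]
      exact α.sizeUpTo_length

lemma boundaries_injective (d : ℕ) :
    Function.Injective (Composition.boundaries : Composition d → Finset (Fin (d + 1))) := by
  intro α β h
  apply (compositionEquiv d).injective
  exact CompositionAsSet.ext h

lemma boundaries_subset_iff {d : ℕ} (α β : Composition d) :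
    α.boundaries ⊆ β.boundaries ↔ ∀ j, ∃ k, β.sizeUpTo k = α.sizeUpTo j := by
  constructor
  · intro h j
    have hlt : α.sizeUpTo j < d + 1 := Nat.lt_succ_of_le (α.sizeUpTo_le j)
    exact (mem_boundaries_iff β ⟨_, hlt⟩).1 (h ((mem_boundaries_iff α ⟨_, hlt⟩).2 ⟨j, rfl⟩))
  · intro h x hx
    obtain ⟨j, hj⟩ := (mem_boundaries_iff α x).1 hx
    obtain ⟨k, hk⟩ := h j
    exact (mem_boundaries_iff β x).2 ⟨k, hk.trans hj⟩

/-- The exponent `m` occurs in the monomial quasi-symmetric function of `β`. -/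
def Occurs {d : ℕ} (β : Composition d) (m : ℕ →₀ ℕ) : Prop :=
  ∃ i : Fin β.length → ℕ, StrictMono i ∧ m = ∑ l, Finsupp.single (i l) (β.blocksFun l)

lemma Occurs.degree_eq {d : ℕ} {β : Composition d} {m : ℕ →₀ ℕ} (h : Occurs β m) :
    m.degree = d := by
  obtain ⟨i, -, rfl⟩ := h
  simp [Composition.sum_blocksFun]

lemma Occurs.exists_psum_iff {d : ℕ} {β : Composition d} {m : ℕ →₀ ℕ} (h : Occurs β m) (s : ℕ) :
    (∃ k, psum m k = s) ↔ ∃ j, β.sizeUpTo j = s := by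
  obtain ⟨i, hi, rfl⟩ := h
  have key : ∀ j k, (∀ l, i l < k ↔ l.val < j) →
      psum (∑ l, Finsupp.single (i l) (β.blocksFun l)) k = β.sizeUpTo j := by
    intro j k hjk
    unfold psum Composition.sizeUpTo
    rw [← β.ofFn_blocksFun, List.sum_take_ofFn, sum_filter]
    simp only [Finsupp.finsetSum_apply]
    rw [sum_comm]
    refine sum_congr rfl fun l _ => ?_
    simp only [Finsupp.single_apply, sum_ite_eq, mem_range, hjk]
  constructor
  · rintro ⟨k, rfl⟩
    by_cases hex : ∃ l, k ≤ i l
    · obtain ⟨l, hl, hmin⟩ : ∃ l, k ≤ i l ∧ ∀ l' < l, i l' < k := by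
        have hwf := wellFounded_lt (α := Fin β.length)
        exact ⟨hwf.min {l | k ≤ i l} hex, hwf.min_mem _ hex,
          fun l' hl' => not_le.1 fun h => hwf.not_lt_min {l | k ≤ i l} h hl'⟩
      refine ⟨l, (key _ _ fun l' => ⟨fun h => ?_, fun h => hmin l' h⟩).symm⟩
      exact hi.lt_iff_lt.1 (h.trans_le hl)
    · push Not at hex
      exact ⟨β.length, (key _ _ fun l => ⟨fun _ => l.2, fun _ => hex l⟩).symm⟩
  · rintro ⟨j, rfl⟩
    by_cases hj : j < β.length
    · exact ⟨i ⟨j, hj⟩, key _ _ fun l => hi.lt_iff_lt⟩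
    · refine ⟨univ.sup i + 1, key _ _ fun l => ⟨fun _ => by omega, fun _ => ?_⟩⟩
      exact Nat.lt_succ_of_le (Finset.le_sup (mem_univ l))

lemma Occurs.unique {d : ℕ} {β γ : Composition d} {m : ℕ →₀ ℕ} (hβ : Occurs β m)
    (hγ : Occurs γ m) : β = γ := by
  apply boundaries_injective
  ext x
  rw [mem_boundaries_iff, mem_boundaries_iff, ← hβ.exists_psum_iff, ← hγ.exists_psum_iff]

/-- Every exponent occurs in a monomial quasi-symmetric function, that of its non-zero entries. -/
lemma exists_occurs (m : ℕ →₀ ℕ) : ∃ β : Composition m.degree, Occurs β m := by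
  let e := m.support.orderEmbOfFin rfl
  have hsum : ∀ {M : Type} [AddCommMonoid M] (f : ℕ → M), ∑ l, f (e l) = ∑ i ∈ m.support, f i := by
    intro M _ f
    conv_rhs => rw [← Finset.map_orderEmbOfFin_univ m.support rfl]
    rw [sum_map]
    rfl
  let β : Composition m.degree :=
    { blocks := List.ofFn fun l => m (e l)
      blocks_pos := by
        intro i hi
        rw [List.mem_ofFn] at hi
        obtain ⟨l, rfl⟩ := hi
        exact Nat.pos_of_ne_zero (Finsupp.mem_support_iff.1 (orderEmbOfFin_mem _ _ l))
      blocks_sum := by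
        rw [List.sum_ofFn, hsum fun i => m i, Finsupp.degree_apply] }
  have hlen : β.length = m.support.card := List.length_ofFn
  refine ⟨β, fun l => e (Fin.cast hlen l), fun a b h => e.strictMono h, ?_⟩
  have hb : ∀ l, β.blocksFun l = m (e (Fin.cast hlen l)) := fun l => by
    simp [Composition.blocksFun, β]
    rfl
  simp only [hb]
  have hcast := (finCongr hlen).sum_comp fun l => Finsupp.single (e l) (m (e l))
  exact (Finsupp.sum_single m).symm.trans
    ((hsum fun i => Finsupp.single i (m i)).symm.trans hcast.symm)

/-- The coefficients of `F_α`: it contains exactly the exponents whose sequence of non-zero entries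
is a composition which refines `α`. -/
lemma fundamentalQuasiSymm_eq_fund {d : ℕ} (α : Composition d) :
    fundamentalQuasiSymm α = fund α.blocks := by
  classical
  have hM : ∀ (β : Composition d) (m : ℕ →₀ ℕ),
      coeff m (monomialQuasiSymm β) = if Occurs β m then 1 else 0 := by
    intro β m
    change (if _ then _ else _) = _
    unfold Occurs
    congr
  ext m
  unfold fundamentalQuasiSymm
  rw [map_sum, coeff_fund]
  simp only [hM]
  by_cases hdeg : m.degree = d
  · subst hdeg
    obtain ⟨β, hβ⟩ := exists_occurs m
    have : ∀ γ, Occurs γ m ↔ β = γ :=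
      fun γ => ⟨fun h => hβ.unique h, fun h => h ▸ hβ⟩
    simp only [this, sum_ite_eq, mem_filter, mem_univ, true_and]
    congr 1
    rw [eq_iff_iff, boundaries_subset_iff, Fits, α.blocks_sum]
    simp only [true_and, ← hβ.exists_psum_iff]
    rfl
  · rw [if_neg fun h => hdeg (h.1.trans α.blocks_sum)]
    exact sum_eq_zero fun β _ => if_neg fun h => hdeg h.degree_eq

lemma fund_mem_idealJ {l : List ℕ} (hpos : ∀ i ∈ l, 0 < i) (hl : l ≠ []) : fund l ∈ idealJ := by
  let α : Composition l.sum := ⟨l, fun {i} hi => hpos i hi, rfl⟩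
  refine Ideal.subset_span ⟨l.sum, α, ?_, (fundamentalQuasiSymm_eq_fund α).symm⟩
  obtain ⟨a, l, rfl⟩ := List.exists_cons_of_ne_nil hl
  have := hpos a (by simp)
  simp
  omega

/-! ### Splitting off the first variable -/

/-- The exponent `(m₁, m₂, …)`. -/
noncomputable def tail (m : ℕ →₀ ℕ) : ℕ →₀ ℕ := m.comapDomain Nat.succ Nat.succ_injective.injOn

@[simp] lemma tail_apply (m : ℕ →₀ ℕ) (i : ℕ) : tail m i = m (i + 1) := rfl

lemma single_add_insertZero_tail (m : ℕ →₀ ℕ) :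
    Finsupp.single 0 (m 0) + insertZero 0 (tail m) = m := by
  ext i
  cases i with
  | zero => simp
  | succ i => rw [Finsupp.add_apply, insertZero_succ (Nat.zero_le i)]; simp

lemma degree_eq_add_degree_tail (m : ℕ →₀ ℕ) : m.degree = m 0 + (tail m).degree := by
  conv_lhs => rw [← single_add_insertZero_tail m]
  rw [map_add, Finsupp.degree_single, degree_insertZero]

lemma psum_succ_eq_add_psum_tail (m : ℕ →₀ ℕ) (k : ℕ) :
    psum m (k + 1) = m 0 + psum (tail m) k := by
  unfold psum
  rw [sum_range_succ', add_comm]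
  rfl

lemma tail_add_single_zero (m : ℕ →₀ ℕ) : tail (m + Finsupp.single 0 1) = tail m := by
  ext i
  simp

lemma tail_add_single_succ (m : ℕ →₀ ℕ) (j : ℕ) :
    tail (m + Finsupp.single (j + 1) 1) = tail m + Finsupp.single j 1 := by
  ext i
  simp [Finsupp.single_apply]

lemma Fits.apply_zero_le {c : ℕ} {l : List ℕ} {m : ℕ →₀ ℕ} (h : Fits (c :: l) m) (hc : 0 < c) :
    m 0 ≤ c := by
  obtain ⟨k, hk⟩ := h.2 1
  simp only [List.take_succ_cons, List.take_zero, List.sum_singleton] at hk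
  cases k with
  | zero => rw [psum_zero] at hk; omega
  | succ k => rw [psum_succ_eq_add_psum_tail] at hk; omega

lemma fits_cons_iff {c : ℕ} {l : List ℕ} {m : ℕ →₀ ℕ} (h0 : m 0 = c) :
    Fits (c :: l) m ↔ Fits l (tail m) := by
  subst h0
  unfold Fits
  rw [degree_eq_add_degree_tail, List.sum_cons, add_right_inj]
  refine and_congr_right fun _ => ⟨fun h j => ?_, fun h j => ?_⟩
  · obtain ⟨k, hk⟩ := h (j + 1)
    rw [List.take_succ_cons, List.sum_cons] at hk
    cases k with
    | zero => exact ⟨0, by rw [psum_zero] at hk ⊢; omega⟩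
    | succ k => exact ⟨k, by rw [psum_succ_eq_add_psum_tail] at hk; omega⟩
  · cases j with
    | zero => exact ⟨0, rfl⟩
    | succ j =>
      obtain ⟨k, hk⟩ := h j
      exact ⟨k + 1, by rw [psum_succ_eq_add_psum_tail, hk, List.take_succ_cons, List.sum_cons]⟩

lemma fits_iff_of_apply_zero {l : List ℕ} {m : ℕ →₀ ℕ} (h0 : m 0 = 0) :
    Fits l m ↔ Fits l (tail m) := by
  unfold Fits
  rw [degree_eq_add_degree_tail, h0, zero_add]
  refine and_congr_right fun _ => forall_congr' fun j => ⟨?_, ?_⟩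
  · rintro ⟨k, hk⟩
    cases k with
    | zero => exact ⟨0, hk⟩
    | succ k => exact ⟨k, by rw [psum_succ_eq_add_psum_tail] at hk; omega⟩
  · rintro ⟨k, hk⟩
    exact ⟨k + 1, by rw [psum_succ_eq_add_psum_tail]; omega⟩

lemma fits_succ_cons_add_single_iff {a : ℕ} (ha : 0 < a) {l : List ℕ} {m : ℕ →₀ ℕ} :
    Fits ((a + 1) :: l) (m + Finsupp.single 0 1) ↔ Fits (a :: l) m := by
  have hp : ∀ k, psum (m + Finsupp.single 0 1) (k + 1) = psum m (k + 1) + 1 := fun k => by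
    rw [psum_add, psum_single_of_lt (by omega)]
  unfold Fits
  rw [map_add, Finsupp.degree_single, List.sum_cons, List.sum_cons]
  refine and_congr (by omega) (forall_congr' fun j => ?_)
  cases j with
  | zero => exact ⟨fun _ => ⟨0, rfl⟩, fun _ => ⟨0, rfl⟩⟩
  | succ j =>
    rw [List.take_succ_cons, List.sum_cons, List.take_succ_cons, List.sum_cons]
    constructor
    · rintro ⟨k, hk⟩
      cases k with
      | zero => rw [psum_zero] at hk; omega
      | succ k => exact ⟨k + 1, by rw [hp] at hk; omega⟩
    · rintro ⟨k, hk⟩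
      cases k with
      | zero => rw [psum_zero] at hk; omega
      | succ k => exact ⟨k + 1, by rw [hp]; omega⟩

/-- `IsTop c g g'` says that `g(x₀, x₁, …) = x₀ ^ c * g'(x₁, x₂, …) + ⋯`, where the dots stand for
terms of degree less than `c` in `x₀`. -/
def IsTop (c : ℕ) (g g' : Series) : Prop :=
  ∀ m, (c < m 0 → coeff m g = 0) ∧ (m 0 = c → coeff m g = coeff (tail m) g')

lemma IsTop.sub {c : ℕ} {g g' h h' : Series} (hg : IsTop c g g') (hh : IsTop c h h') :
    IsTop c (g - h) (g' - h') := fun m =>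
  ⟨fun hm => by rw [map_sub, (hg m).1 hm, (hh m).1 hm, sub_zero],
    fun hm => by rw [map_sub, map_sub, (hg m).2 hm, (hh m).2 hm]⟩

lemma IsTop.X_mul {c : ℕ} {g g' : Series} (hg : IsTop c g g') (j : ℕ) :
    IsTop c (X (j + 1) * g) (X j * g') := by
  intro m
  by_cases hm : m (j + 1) = 0
  · rw [coeff_X_mul_of_eq_zero hm, coeff_X_mul_of_eq_zero (m := tail m) hm]
    exact ⟨fun _ => rfl, fun _ => rfl⟩
  · obtain ⟨m, rfl⟩ := exists_add_single hm
    rw [coeff_add_single_X_mul, tail_add_single_succ, coeff_add_single_X_mul]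
    simpa using hg m

lemma isTop_fund_cons {c : ℕ} (hc : 0 < c) (l : List ℕ) : IsTop c (fund (c :: l)) (fund l) := by
  intro m
  exact ⟨fun h => coeff_fund_of_not_fits fun hf => (hf.apply_zero_le hc).not_gt h,
    fun h => coeff_fund_congr (fits_cons_iff h)⟩

/-! ### Elements of the ideal with prescribed leading monomial -/

/-- The series with leading monomial of exponent `(v.reverse, β₁ + 1, β₂ + 1, …)`. The last zero
which precedes a positive entry is removed by the rule
`G(w, 0, a, β) = G(w, a, β) - x_k * G(w, a - 1, β)`, where `k` is the length of `w`, until the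
exponent is a composition, for which `G` is the fundamental quasi-symmetric function. The prefix `v`
is stored in reverse, and the positive entries that follow it are stored diminished by one. -/
noncomputable def leadingSeries : List ℕ → List ℕ → Series
  | [], β => fund (β.map (· + 1))
  | (a + 1) :: v, β => leadingSeries v (a :: β)
  | 0 :: v, [] => leadingSeries v []
  | 0 :: v, 0 :: β => leadingSeries v (0 :: β) - X v.length * leadingSeries (0 :: v) β
  | 0 :: v, (b + 1) :: β => leadingSeries v ((b + 1) :: β) - X v.length * leadingSeries v (b :: β)
termination_by v β => (v.length, β.length)

lemma isTop_leadingSeries_zero (β : List ℕ) :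
    IsTop 0 (leadingSeries [0] β) (fund (β.map (· + 1))) := by
  induction β with
  | nil =>
    intro m
    simp only [leadingSeries, List.map_nil]
    refine ⟨fun h => coeff_fund_of_not_fits fun hf => ?_,
      fun h => coeff_fund_congr (fits_iff_of_apply_zero h)⟩
    have := hf.1
    rw [degree_eq_add_degree_tail, List.sum_nil] at this
    omega
  | cons b β ih =>
    intro m
    by_cases hm : m 0 = 0
    · refine ⟨fun h => by omega, fun _ => ?_⟩
      cases b <;>
      · simp only [leadingSeries, List.length_nil]
        rw [map_sub, coeff_X_mul_of_eq_zero hm, sub_zero]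
        exact coeff_fund_congr (fits_iff_of_apply_zero hm)
    · refine ⟨fun _ => ?_, fun h => absurd h hm⟩
      obtain ⟨m, rfl⟩ := exists_add_single hm
      cases b with
      | zero =>
        simp only [leadingSeries, List.length_nil, List.map_cons]
        rw [map_sub, coeff_add_single_X_mul]
        by_cases h0 : m 0 = 0
        · rw [(ih m).2 h0, sub_eq_zero]
          refine coeff_fund_congr ?_
          rw [fits_cons_iff (by simp [h0]), tail_add_single_zero]
        · rw [(ih m).1 (by omega), coeff_fund_of_not_fits, sub_zero]
          intro hf
          have := hf.apply_zero_le (by omega)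
          rw [Finsupp.add_apply, Finsupp.single_eq_same] at this
          omega
      | succ b =>
        simp only [leadingSeries, List.length_nil, List.map_cons]
        rw [map_sub, coeff_add_single_X_mul, sub_eq_zero]
        exact coeff_fund_congr (fits_succ_cons_add_single_iff (by omega))

/-- The recursion, which works from the right, is compatible with splitting off the first variable
on the left. -/
lemma isTop_leadingSeries (c : ℕ) (v β : List ℕ) :
    IsTop c (leadingSeries (v ++ [c]) β) (leadingSeries v β) := by
  induction v, β using leadingSeries.induct with
  | case1 β =>
    cases c with
    | zero => simpa [leadingSeries] using isTop_leadingSeries_zero β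
    | succ c => simpa [leadingSeries] using isTop_fund_cons (by omega) (β.map (· + 1))
  | case2 a v β ih => simpa only [leadingSeries, List.cons_append] using ih
  | case3 v ih => simpa only [leadingSeries, List.cons_append] using ih
  | case4 v β ih₁ ih₂ =>
    simp only [leadingSeries, List.cons_append, List.length_append, List.length_singleton]
    exact ih₁.sub (ih₂.X_mul _)
  | case5 v b β ih₁ ih₂ =>
    simp only [leadingSeries, List.cons_append, List.length_append, List.length_singleton]
    exact ih₁.sub (ih₂.X_mul _)

lemma toLex_lt_of_apply_zero_lt {a b : ℕ →₀ ℕ} (h : a 0 < b 0) : toLex a < toLex b :=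
  toLex_lt_of 0 (fun _ hk => absurd hk (Nat.not_lt_zero _)) h

lemma toLex_le_of_tail {a b : ℕ →₀ ℕ} (h0 : a 0 = b 0) (h : toLex (tail a) ≤ toLex (tail b)) :
    toLex a ≤ toLex b := by
  rw [← single_add_insertZero_tail a, ← single_add_insertZero_tail b, h0]
  exact add_le_add_right (toLex_insertZero_le 0 h) (toLex (Finsupp.single 0 (b 0)))

/-- The list of the first `n` entries of an exponent, in reverse. -/
def revEntries (n : ℕ) (ε : ℕ →₀ ℕ) : List ℕ := ((List.range n).map ε).reverse

lemma revEntries_succ (n : ℕ) (ε : ℕ →₀ ℕ) :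
    revEntries (n + 1) ε = revEntries n (tail ε) ++ [ε 0] := by
  simp [revEntries, List.range_succ_eq_map, Function.comp_def]

lemma leadingSeries_leading (n : ℕ) {ε : ℕ →₀ ℕ} (hε : ∀ i, n ≤ i → ε i = 0) :
    coeff ε (leadingSeries (revEntries n ε) []) = 1 ∧
      ∀ m, coeff m (leadingSeries (revEntries n ε) []) ≠ 0 → toLex m ≤ toLex ε := by
  induction n generalizing ε with
  | zero =>
    obtain rfl : ε = 0 := Finsupp.ext fun i => hε i (Nat.zero_le i)
    simp only [revEntries, List.range_zero, List.map_nil, List.reverse_nil, leadingSeries]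
    refine ⟨coeff_fund_of_fits ⟨map_zero _, fun j => ⟨0, by simp⟩⟩, fun m hm => ?_⟩
    have : m.degree = 0 := (not_imp_comm.1 coeff_fund_of_not_fits hm).1
    rw [(Finsupp.degree_eq_zero_iff m).1 this]
  | succ n ih =>
    rw [revEntries_succ]
    have htop := isTop_leadingSeries (ε 0) (revEntries n (tail ε)) []
    obtain ⟨h1, hle⟩ := ih (ε := tail ε) fun i hi => hε (i + 1) (by omega)
    refine ⟨by rw [(htop ε).2 rfl, h1], fun m hm => ?_⟩
    rcases lt_trichotomy (m 0) (ε 0) with h | h | h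
    · exact (toLex_lt_of_apply_zero_lt h).le
    · exact toLex_le_of_tail h (hle _ (by rwa [← (htop m).2 h]))
    · exact absurd ((htop m).1 h) hm

/-- Some non-empty prefix of length `p` of the list, padded by zeros, has sum at least `p`: the
corresponding path crosses the line `y = x`. -/
def Exceeds (u : List ℕ) : Prop := ∃ p, 0 < p ∧ p ≤ (u.take p).sum

/-- Both terms of the recursion for `leadingSeries` inherit the crossing of the line `y = x`: removing
the zero shortens the prefix by one, and lowering the next entry diminishes its sum by at most one. -/
lemma Exceeds.remove_zero {w β : List ℕ} {b : ℕ} (h : Exceeds (w ++ 0 :: (b + 1) :: β)) :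
    Exceeds (w ++ (b + 1) :: β) ∧ Exceeds (w ++ b :: β) := by
  obtain ⟨p, hp, hle⟩ := h
  rw [List.take_append, List.sum_append] at hle
  obtain hpw | hpw | ⟨q, hq⟩ : p ≤ w.length ∨ p = w.length + 1 ∨ ∃ q, p = w.length + (q + 2) := by
    rcases le_or_gt p (w.length + 1) with h | h
    · omega
    · exact Or.inr (Or.inr ⟨p - w.length - 2, by omega⟩)
  · rw [Nat.sub_eq_zero_of_le hpw, List.take_zero, List.sum_nil] at hle
    constructor <;> refine ⟨p, hp, ?_⟩ <;> rw [List.take_append, List.sum_append] <;> omega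
  · rw [hpw, Nat.add_sub_cancel_left, List.take_succ_cons, List.take_zero, List.sum_singleton,
      ← hpw] at hle
    constructor <;> refine ⟨p, hp, ?_⟩ <;> rw [List.take_append, List.sum_append] <;> omega
  · have h1 : p - w.length = q + 2 := by omega
    have h2 : p - 1 - w.length = q + 1 := by omega
    rw [h1, List.take_succ_cons, List.take_succ_cons, List.sum_cons, List.sum_cons,
      List.take_of_length_le (by omega)] at hle
    constructor <;> refine ⟨p - 1, by omega, ?_⟩ <;>
      rw [List.take_append, List.sum_append, h2, List.take_succ_cons, List.sum_cons,
        List.take_of_length_le (by omega)] <;> omega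

lemma leadingSeries_mem_idealJ {v β : List ℕ} (h : Exceeds (v.reverse ++ β.map (· + 1))) :
    leadingSeries v β ∈ idealJ := by
  induction v, β using leadingSeries.induct with
  | case1 β =>
    rw [leadingSeries]
    refine fund_mem_idealJ (by simp) ?_
    rintro h0
    obtain ⟨p, hp, hle⟩ := h
    simp [h0] at hle
    omega
  | case2 a v β ih =>
    rw [leadingSeries]
    exact ih (by simpa using h)
  | case3 v ih =>
    rw [leadingSeries]
    refine ih ?_
    obtain ⟨p, hp, hle⟩ := h
    refine ⟨p, hp, hle.trans (le_of_eq ?_)⟩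
    have hz : (List.take (p - v.length) [0]).sum = 0 := by
      cases p - v.length <;> simp
    simp [List.take_append, hz]
  | case4 v β ih₁ ih₂ =>
    have h' := Exceeds.remove_zero (w := v.reverse) (b := 0) (β := β.map (· + 1)) (by simpa using h)
    rw [leadingSeries]
    exact sub_mem (ih₁ (by simpa using h'.1)) (Ideal.mul_mem_left _ _ (ih₂ (by simpa using h'.2)))
  | case5 v b β ih₁ ih₂ =>
    have h' := Exceeds.remove_zero (w := v.reverse) (b := b + 1) (β := β.map (· + 1))
      (by simpa using h)
    rw [leadingSeries]
    exact sub_mem (ih₁ (by simpa using h'.1)) (Ideal.mul_mem_left _ _ (ih₂ (by simpa using h'.2)))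

lemma sum_map_range (m : ℕ →₀ ℕ) (n : ℕ) : ((List.range n).map m).sum = psum m n := by
  induction n with
  | zero => rfl
  | succ n ih => rw [List.range_succ, List.map_append, List.sum_append, ih, psum_succ]; simp

lemma exceeds_of_not_isCatalan {n : ℕ} {ε : ℕ →₀ ℕ} (hε : ∀ i, n ≤ i → ε i = 0)
    (h : ¬ IsCatalan ε) : Exceeds ((List.range n).map ε) := by
  rw [isCatalan_iff] at h
  push Not at h
  obtain ⟨k, hk⟩ := h
  refine ⟨k + 1, by omega, hk.trans_eq ?_⟩
  rw [← List.map_take, List.take_range, sum_map_range]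
  rcases le_total (k + 1) n with h | h
  · rw [min_eq_left h]
  · rw [min_eq_right h]
    refine (sum_subset (range_mono h) fun i _ hi => hε i ?_).symm
    simpa using hi

/-- Every exponent which is not Catalan is the leading exponent of an element of the ideal. -/
lemma exists_mem_idealJ_leading {ε : ℕ →₀ ℕ} (h : ¬ IsCatalan ε) :
    ∃ g ∈ idealJ, coeff ε g = 1 ∧ ∀ m, coeff m g ≠ 0 → toLex m ≤ toLex ε := by
  obtain ⟨n, hn⟩ := exists_mem_box ε
  refine ⟨_, leadingSeries_mem_idealJ ?_, leadingSeries_leading n hn.1⟩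
  simpa [revEntries] using exceeds_of_not_isCatalan hn.1 h

/-! ### Spanning in a finite box -/

/-- The series all of whose coefficients in the box `n` sit at Catalan exponents. -/
def catalanOnBox (n : ℕ) : Submodule ℚ Series where
  carrier := {f | ∀ m ∈ box n, ¬ IsCatalan m → coeff m f = 0}
  zero_mem' _ _ _ := map_zero _
  add_mem' hf hg m hm hc := by rw [map_add, hf m hm hc, hg m hm hc, add_zero]
  smul_mem' a f hf m hm hc := by rw [map_smul, hf m hm hc, smul_zero]

lemma mem_idealJ_sup_catalanOnBox_of_monomials {n : ℕ} {f : Series}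
    (h : ∀ m ∈ box n, coeff m f ≠ 0 →
      monomial m 1 ∈ idealJ.restrictScalars ℚ ⊔ catalanOnBox n) :
    f ∈ idealJ.restrictScalars ℚ ⊔ catalanOnBox n := by
  classical
  have hs : ∑ m ∈ (finite_box n).toFinset, coeff m f • monomial m (1 : ℚ) ∈
      idealJ.restrictScalars ℚ ⊔ catalanOnBox n := by
    refine sum_mem fun m hm => ?_
    by_cases h0 : coeff m f = 0
    · rw [h0, zero_smul]
      exact zero_mem _
    · exact Submodule.smul_mem _ _ (h m ((Set.Finite.mem_toFinset _).1 hm) h0)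
  rw [← sub_add_cancel f (∑ m ∈ (finite_box n).toFinset, coeff m f • monomial m (1 : ℚ))]
  refine add_mem (Submodule.mem_sup_right fun m hm _ => ?_) hs
  rw [map_sub, map_sum, sum_eq_single_of_mem m ((Set.Finite.mem_toFinset _).2 hm)]
  · rw [map_smul, coeff_monomial_same, smul_eq_mul, mul_one, sub_self]
  · intro b _ hb
    rw [map_smul, coeff_monomial_ne hb.symm, smul_zero]

/-- Modulo the ideal, every series has only Catalan exponents in the box `n`. -/
lemma idealJ_sup_catalanOnBox (n : ℕ) : idealJ.restrictScalars ℚ ⊔ catalanOnBox n = ⊤ := by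
  refine eq_top_iff.2 fun f _ => mem_idealJ_sup_catalanOnBox_of_monomials fun m hm _ => ?_
  by_contra hne
  have hfin : {m | m ∈ box n ∧
      monomial m 1 ∉ idealJ.restrictScalars ℚ ⊔ catalanOnBox n}.Finite :=
    (finite_box n).subset fun _ h => h.1
  -- At the least exponent not covered, subtracting an element of the ideal with this leading
  -- exponent leaves only smaller exponents.
  obtain ⟨c, ⟨hc, hcW⟩, hmin⟩ := hfin.exists_minimalFor toLex _ ⟨m, hm, hne⟩
  refine hcW ?_
  by_cases hcat : IsCatalan c
  · refine Submodule.mem_sup_right fun m _ hm => coeff_monomial_ne ?_ _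
    rintro rfl
    exact hm hcat
  · obtain ⟨g, hg, h1, hle⟩ := exists_mem_idealJ_leading hcat
    rw [← sub_add_cancel (monomial c 1) g]
    refine add_mem (mem_idealJ_sup_catalanOnBox_of_monomials fun m hm hmc => ?_)
      (Submodule.mem_sup_left hg)
    by_contra hW
    have hmc' : m ≠ c := by
      rintro rfl
      rw [map_sub, coeff_monomial_same, h1, sub_self] at hmc
      exact hmc rfl
    rw [map_sub, coeff_monomial_ne hmc', zero_sub, neg_ne_zero] at hmc
    exact hmc' (toLex_inj.1 (le_antisymm (hle m hmc) (hmin ⟨hm, hW⟩ (hle m hmc))))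

lemma exists_mem_idealJ_sub_mem_catalanOnBox (n : ℕ) (f : Series) :
    ∃ j ∈ idealJ, f - j ∈ catalanOnBox n := by
  have hf : f ∈ idealJ.restrictScalars ℚ ⊔ catalanOnBox n := by
    rw [idealJ_sup_catalanOnBox]
    trivial
  obtain ⟨j, hj, g, hg, rfl⟩ := Submodule.mem_sup.1 hf
  exact ⟨j, hj, by rwa [add_sub_cancel_left]⟩

/-! ### Passage to the closure -/

lemma mem_closure_idealJ_iff {f : Series} :
    f ∈ idealJ.closure ↔ ∀ n, ∃ j ∈ idealJ, ∀ m ∈ box n, coeff m j = coeff m f := by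
  let _ : TopologicalSpace ℚ := ⊥
  have : DiscreteTopology ℚ := ⟨rfl⟩
  rw [← SetLike.mem_coe, Ideal.coe_closure]
  constructor
  · intro hf n
    have hopen : IsOpen (⋂ m ∈ box n, (fun g : Series => coeff m g) ⁻¹' {coeff m f}) :=
      (finite_box n).isOpen_biInter fun m _ =>
        (isOpen_discrete _).preimage (WithPiTopology.continuous_coeff ℚ m)
    obtain ⟨j, hj, hjJ⟩ := mem_closure_iff.1 hf _ hopen (by simp)
    exact ⟨j, hjJ, fun m hm => by simpa using Set.mem_iInter₂.1 hj m hm⟩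
  · intro h
    choose j hj hjf using h
    refine mem_closure_of_tendsto (b := Filter.atTop) (f := j) ?_ (Filter.Eventually.of_forall hj)
    refine (WithPiTopology.tendsto_iff_coeff_tendsto j Filter.atTop f).2 fun m => ?_
    obtain ⟨n, hn⟩ := exists_mem_box m
    refine tendsto_const_nhds.congr' ?_
    filter_upwards [Filter.eventually_ge_atTop n] with k hk
    exact (hjf k m (box_mono hk hn)).symm

/-- Independence of the Catalan monomials modulo the closure of the ideal. -/
lemma eq_zero_of_mem_closure_idealJ {f : Series} (hf : f ∈ idealJ.closure)
    (hcat : ∀ m, ¬ IsCatalan m → coeff m f = 0) : f = 0 := by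
  ext m
  obtain ⟨n, hn⟩ := exists_mem_box m
  obtain ⟨j, hj, hjf⟩ := mem_closure_idealJ_iff.1 hf n
  rw [← hjf m hn, map_zero]
  exact coeff_eq_zero_of_mem_idealJ hj (fun m hm hc => (hjf m hm).trans (hcat m hc)) hn

open Classical in
/-- The series `∑ c_α X^α` over the Catalan exponents `α`. -/
noncomputable def catalanSeries (c : {α : ℕ →₀ ℕ // IsCatalan α} → ℚ) : Series :=
  fun m => if h : IsCatalan m then c ⟨m, h⟩ else 0

lemma coeff_catalanSeries (c : {α : ℕ →₀ ℕ // IsCatalan α} → ℚ)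
    (α : {α : ℕ →₀ ℕ // IsCatalan α}) : coeff α.1 (catalanSeries c) = c α :=
  dif_pos α.2

lemma coeff_catalanSeries_of_not (c : {α : ℕ →₀ ℕ // IsCatalan α} → ℚ) {m : ℕ →₀ ℕ}
    (hm : ¬ IsCatalan m) : coeff m (catalanSeries c) = 0 :=
  dif_neg hm

/-- Modulo the closure of the ideal, every series is a series in the Catalan monomials. -/
lemma exists_sub_catalanSeries_mem (f : Series) : ∃ c, f - catalanSeries c ∈ idealJ.closure := by
  choose j hj hjf using fun n => exists_mem_idealJ_sub_mem_catalanOnBox n f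
  choose N hN using exists_mem_box
  -- By independence, the corrections `j n` agree wherever they are relevant.
  have hle : ∀ {n k m}, n ≤ k → m ∈ box n → coeff m (j n) = coeff m (j k) := by
    intro n k m hnk hm
    have h := coeff_eq_zero_of_mem_idealJ (n := n) (sub_mem (hj n) (hj k)) (fun m hm hc => ?_) hm
    · rwa [map_sub, sub_eq_zero] at h
    · have h₁ := hjf n m hm hc
      have h₂ := hjf k m (box_mono hnk hm) hc
      rw [map_sub] at h₁ h₂ ⊢
      linarith
  have heq : ∀ {n k m}, m ∈ box n → m ∈ box k → coeff m (j n) = coeff m (j k) := by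
    intro n k m hn hk
    rcases le_total n k with h | h
    · exact hle h hn
    · exact (hle h hk).symm
  refine ⟨fun α => coeff α.1 (f - j (N α.1)),
    mem_closure_idealJ_iff.2 fun n => ⟨j n, hj n, fun m hm => ?_⟩⟩
  rw [map_sub]
  by_cases hc : IsCatalan m
  · rw [coeff_catalanSeries _ ⟨m, hc⟩, map_sub, sub_sub_cancel, heq hm (hN m)]
  · rw [coeff_catalanSeries_of_not _ hc, sub_zero]
    have h := hjf n m hm hc
    rw [map_sub] at h
    linarith

/-! ### Convergence -/

lemma hasSum_catalanSeries (c : {α : ℕ →₀ ℕ // IsCatalan α} → ℚ) :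
    HasSum (fun α : {α : ℕ →₀ ℕ // IsCatalan α} => c α • (monomial α.1 (1 : ℚ) : Series))
      (catalanSeries c) := by
  classical
  let _ : TopologicalSpace ℚ := ⊥
  refine (WithPiTopology.tendsto_iff_coeff_tendsto _ _ _).2 fun m => ?_
  refine tendsto_const_nhds.congr' ?_
  by_cases hm : IsCatalan m
  · filter_upwards [Filter.eventually_ge_atTop {⟨m, hm⟩}] with s hs
    rw [coeff_catalanSeries c ⟨m, hm⟩, map_sum,
      sum_eq_single_of_mem ⟨m, hm⟩ (hs (mem_singleton_self _))]
    · rw [map_smul, coeff_monomial_same, smul_eq_mul, mul_one]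
    · intro b _ hb
      rw [map_smul, coeff_monomial_ne, smul_zero]
      exact fun h => hb (Subtype.ext h.symm)
  · refine Filter.Eventually.of_forall fun s => ?_
    beta_reduce
    rw [coeff_catalanSeries_of_not c hm, map_sum]
    refine (sum_eq_zero fun b _ => ?_).symm
    rw [map_smul, coeff_monomial_ne, smul_zero]
    rintro rfl
    exact hm b.2

lemma hasSum_monomialClass (c : {α : ℕ →₀ ℕ // IsCatalan α} → ℚ) :
    HasSum (fun α : {α : ℕ →₀ ℕ // IsCatalan α} => c α • monomialClass α.1)
      (Ideal.Quotient.mk idealJ.closure (catalanSeries c)) :=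
  (hasSum_catalanSeries c).map (Ideal.Quotient.mk idealJ.closure)
    (QuotientRing.isOpenQuotientMap_mk idealJ.closure).continuous

lemma t2Space_R : T2Space R := by
  have : IsClosed (idealJ.closure : Set Series) := by
    rw [Ideal.coe_closure]
    exact isClosed_closure
  have : T3Space (Series ⧸ idealJ.closure) := Submodule.t3_quotient_of_isClosed idealJ.closure
  infer_instance

end QuasiSymm

open QuasiSymm in
theorem theorem1 :
    QuasiSymm.IsHilbertBasis
      (fun α : {α : ℕ →₀ ℕ // QuasiSymm.IsCatalan α} => QuasiSymm.monomialClass α.1) := by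
  refine ⟨fun c => (hasSum_monomialClass c).summable, fun r => ?_⟩
  have := t2Space_R
  obtain ⟨f, rfl⟩ := Ideal.Quotient.mk_surjective r
  obtain ⟨c, hc⟩ := exists_sub_catalanSeries_mem f
  have hfc := Ideal.Quotient.eq.2 hc
  refine ⟨c, hfc ▸ hasSum_monomialClass c, fun c' hc' => ?_⟩
  have h := (hasSum_monomialClass c').unique (hfc ▸ hc')
  have h0 := eq_zero_of_mem_closure_idealJ (Ideal.Quotient.eq.1 h) fun m hm => by
    rw [map_sub, coeff_catalanSeries_of_not _ hm, coeff_catalanSeries_of_not _ hm, sub_zero]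
  funext α
  rw [← coeff_catalanSeries c', ← coeff_catalanSeries c, sub_eq_zero.1 h0]
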